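/- Let $\mathbb{K}$ be a field of characteristic zero. A mixed graph $G$ consists of a finite set $V(G)$ of vertices, a set $E(G)$ of edges $\{x,y\}\subseteq V(G)$ with $x\ne y$, and a set $A(G)$ of arcs $(x,y)\in V(G)^2$ with $x\neq y$, such that if $\{x,y\}\in E(G)$ then neither $(x,y)$ nor $(y,x)$ is in $A(G)$. An ideal of $G$ is a set $I\subseteq V(G)$ such that $x\in I$ and $(x,y)\in A(G)$ imply $y\in I$; for $I\subseteq V(G)$, $G_{|I}$ is the mixed graph induced on $I$. Let $\mathcal{F}[\mathbf{G}]$ be the $\mathbb{K}$-vector space with basis the isomorphism classes of mixed graphs, let $1$ be the empty mixed graph, and put $$\Delta(G)=\sum_{I \text{ ideal of } G} G_{|V(G)\setminus I}\otimes G_{|I},\qquad \varepsilon(1)=1,\quad \varepsilon(G)=0 \text{ if } G\neq 1.$$ For mixed graphs $G,H$ let $G\curvearrowright H$ be the disjoint union of $G$ and $H$ to which all arcs from a vertex of $G$ to a vertex of $H$ are added, and extend $\curvearrowright$ bilinearly to $\mathcal{F}[\mathbf{G}]$. Let $$\mathrm{Prim}(\mathcal{F}[\mathbf{G}])=\{x\in\mathcal{F}[\mathbf{G}]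 : \Delta(x)=x\otimes 1+1\otimes x\}.$$ 1. $(\mathcal{F}[\mathbf{G}],\curvearrowright,\Delta)$ is a unital infinitesimal bialgebra: $\curvearrowright$ is associative with unit $1$, $\Delta$ is coassociative with counit $\varepsilon$, and for all $x,y\in\mathcal{F}[\mathbf{G}]$, $$\Delta(x\curvearrowright y)=(x\otimes 1)\curvearrowright\Delta(y)+\Delta(x)\curvearrowright(1\otimes y)-x\otimes y,$$ where $\curvearrowright$ acts componentwise on $\mathcal{F}[\mathbf{G}]\otimes\mathcal{F}[\mathbf{G}]$. 2. The coalgebra $(\mathcal{F}[\mathbf{G}],\Delta,\varepsilon)$ is cofree, in the sense that it is isomorphic, as a counital coalgebra, to the tensor coalgebra $T(V)=\bigoplus_{n\ge 0}V^{\otimes n}$ on $V=\mathrm{Prim}(\mathcal{F}[\mathbf{G}])$, whose coproduct is the deconcatenation $v_1\cdots v_n\mapsto\sum_{i=0}^n v_1\cdots v_i\otimes v_{i+1}\cdots v_n$ and whose counit is the projection onto $V^{\otimes 0}=\mathbb{K}$. -/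

import Mathlib

open scoped TensorProduct

noncomputable section

/-- A mixed graph with vertex set `V`: a set of (unoriented, loopless) edges and a set of
(oriented, loopless) arcs, such that two vertices joined by an edge are joined by no arc.
Both arcs `(x, y)` and `(y, x)` may be present. -/
@[ext]
structure MixedGraph (V : Type*) where
  /-- the edges -/
  edges : SimpleGraph V
  /-- `Arc x y` means that `(x, y)` is an arc -/
  Arc : V → V → Prop
  arc_irrefl : ∀ x, ¬ Arc x x
  not_arc_of_edge : ∀ x y, edges.Adj x y → ¬ Arc x y ∧ ¬ Arc y x

namespace MixedGraph

variable {V W V' W' : Type*}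

/-- Pullback of a mixed graph along an injection of vertex sets. -/
def comap (f : V ↪ W) (G : MixedGraph W) : MixedGraph V where
  edges := G.edges.comap f
  Arc x y := G.Arc (f x) (f y)
  arc_irrefl x := G.arc_irrefl (f x)
  not_arc_of_edge x y h := G.not_arc_of_edge (f x) (f y) h

/-- The restriction `G_{|I}` of `G` to a set `I` of vertices. -/
def restrict (G : MixedGraph V) (I : Set V) : MixedGraph I :=
  G.comap (Function.Embedding.subtype (· ∈ I))

/-- `I` is an ideal of `G` if every arc that starts in `I` ends in `I`. -/
def IsIdeal (G : MixedGraph V) (I : Set V) : Prop :=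
  ∀ x y, x ∈ I → G.Arc x y → y ∈ I

/-- The mixed graph `G ↷ H` : the disjoint union of `G` and `H`, together with all the arcs from a
vertex of `G` to a vertex of `H`. -/
def join (G : MixedGraph V) (H : MixedGraph W) : MixedGraph (V ⊕ W) where
  edges := G.edges ⊕g H.edges
  Arc
    | .inl x, .inl y => G.Arc x y
    | .inr x, .inr y => H.Arc x y
    | .inl _, .inr _ => True
    | .inr _, .inl _ => False
  arc_irrefl := by
    rintro (x | x)
    · exact G.arc_irrefl x
    · exact H.arc_irrefl x
  not_arc_of_edge := by
    rintro (x | x) (y | y) h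
    · exact G.not_arc_of_edge x y (by simpa using h)
    · simp at h
    · simp at h
    · exact H.not_arc_of_edge x y (by simpa using h)

/-- The mixed graph on `V` with neither edges nor arcs. -/
def edgeless (V : Type*) : MixedGraph V where
  edges := ⊥
  Arc _ _ := False
  arc_irrefl _ h := h
  not_arc_of_edge _ _ h := h.elim

/-- Isomorphism of mixed graphs. -/
def Isom (G : MixedGraph V) (H : MixedGraph W) : Prop :=
  ∃ e : V ≃ W, G = H.comap e.toEmbedding

theorem Isom.refl (G : MixedGraph V) : G.Isom G := ⟨Equiv.refl V, rfl⟩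

theorem Isom.symm {G : MixedGraph V} {H : MixedGraph W} (h : G.Isom H) : H.Isom G := by
  obtain ⟨e, rfl⟩ := h
  refine ⟨e.symm, ?_⟩
  ext <;> simp [comap]

theorem Isom.trans {U : Type*} {G : MixedGraph V} {H : MixedGraph W} {K : MixedGraph U}
    (h : G.Isom H) (h' : H.Isom K) : G.Isom K := by
  obtain ⟨e, rfl⟩ := h
  obtain ⟨e', rfl⟩ := h'
  exact ⟨e.trans e', rfl⟩

theorem Isom.join {G : MixedGraph V} {G' : MixedGraph V'} {H : MixedGraph W} {H' : MixedGraph W'}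
    (h : G.Isom G') (h' : H.Isom H') : (G.join H).Isom (G'.join H') := by
  obtain ⟨e, rfl⟩ := h
  obtain ⟨e', rfl⟩ := h'
  refine ⟨Equiv.sumCongr e e', ?_⟩
  ext x y <;> rcases x with x | x <;> rcases y with y | y <;>
    simp [MixedGraph.join, comap]

/-- Isomorphism as an equivalence relation on the mixed graphs with vertex set `{0, …, n - 1}`,
`n` arbitrary. -/
instance isoSetoid : Setoid (Σ n : ℕ, MixedGraph (Fin n)) where
  r G H := G.2.Isom H.2
  iseqv := ⟨fun G => Isom.refl G.2, fun h => h.symm, fun h h' => h.trans h'⟩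

/-- The set of isomorphism classes of finite mixed graphs. -/
def IsoClass : Type := Quotient isoSetoid

/-- The isomorphism class of a mixed graph with finite vertex set. -/
def cls [Finite V] (G : MixedGraph V) : IsoClass :=
  Quotient.mk isoSetoid ⟨Nat.card V, G.comap (Finite.equivFin V).symm.toEmbedding⟩

theorem cls_eq_cls_iff [Finite V] [Finite W] {G : MixedGraph V} {H : MixedGraph W} :
    G.cls = H.cls ↔ G.Isom H := by
  have key : ∀ {U : Type _} [Finite U] (L : MixedGraph U),
      (L.comap (Finite.equivFin U).symm.toEmbedding).Isom L := fun L => ⟨_, rfl⟩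
  have key' : ∀ {U : Type _} [Finite U] (L : MixedGraph U),
      (L.comap (Finite.equivFin U).symm.toEmbedding).Isom L := fun L => ⟨_, rfl⟩
  constructor
  · intro h
    have h2 : (G.comap (Finite.equivFin V).symm.toEmbedding).Isom
        (H.comap (Finite.equivFin W).symm.toEmbedding) := Quotient.exact h
    exact (key G).symm.trans (h2.trans (key' H))
  · intro h
    exact Quotient.sound (show (G.comap (Finite.equivFin V).symm.toEmbedding).Isom
        (H.comap (Finite.equivFin W).symm.toEmbedding) from
      (key G).trans (h.trans (key' H).symm))

/-- The class of the empty mixed graph. -/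
def emptyClass : IsoClass := (edgeless (Fin 0)).cls

/-- The operation `↷` on isomorphism classes. -/
def IsoClass.join : IsoClass → IsoClass → IsoClass :=
  Quotient.lift₂ (fun G H => (G.2.join H.2).cls)
    (fun _ _ _ _ h h' => cls_eq_cls_iff.2 (Isom.join h h'))

theorem cls_join [Finite V] [Finite W] (G : MixedGraph V) (H : MixedGraph W) :
    G.cls.join H.cls = (G.join H).cls :=
  cls_eq_cls_iff.2 (Isom.join ⟨_, rfl⟩ ⟨_, rfl⟩)

end MixedGraph

open MixedGraph

/-- The vector space `F[G]` over `K` with basis the isomorphism classes of finite mixed graphs. -/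
def MixedGraphSpace (K : Type*) [Field K] : Type _ := IsoClass →₀ K

namespace MixedGraphSpace

variable (K : Type*) [Field K]

instance : AddCommGroup (MixedGraphSpace K) := inferInstanceAs (AddCommGroup (IsoClass →₀ K))

instance : Module K (MixedGraphSpace K) := inferInstanceAs (Module K (IsoClass →₀ K))

/-- The basis of `F[G]` given by the isomorphism classes. -/
def basis : Module.Basis IsoClass K (MixedGraphSpace K) :=
  .ofRepr (LinearEquiv.refl K (IsoClass →₀ K))

/-- The basis element of `F[G]` given by a finite mixed graph. -/
def of {V : Type*} [Finite V] (G : MixedGraph V) : MixedGraphSpace K := basis K G.cls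

/-- The element `1` of `F[G]` is the empty mixed graph. -/
instance : One (MixedGraphSpace K) := ⟨basis K emptyClass⟩

open Classical in
/-- `Δ(G) = ∑ G_{|V ∖ I} ⊗ G_{|I}`, the sum being over the ideals `I` of `G`. -/
def comulGraph {V : Type*} [Fintype V] (G : MixedGraph V) :
    MixedGraphSpace K ⊗[K] MixedGraphSpace K :=
  ∑ I : Set V with G.IsIdeal I, of K (G.restrict Iᶜ) ⊗ₜ[K] of K (G.restrict I)

theorem restrict_isom {V W : Type*} (e : V ≃ W) (H : MixedGraph W)
    {I : Set V} {J : Set W} (h : ∀ x, x ∈ I ↔ e x ∈ J) :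
    ((H.comap e.toEmbedding).restrict I).Isom (H.restrict J) :=
  ⟨e.subtypeEquiv h, rfl⟩

theorem comulGraph_eq_of_isom {V W : Type*} [Fintype V] [Fintype W] {G : MixedGraph V}
    {H : MixedGraph W} (h : G.Isom H) : comulGraph K G = comulGraph K H := by
  classical
  obtain ⟨e, rfl⟩ := h
  refine Finset.sum_equiv (Equiv.Set.congr e) ?_ ?_
  · intro I
    simp only [Finset.mem_filter, Finset.mem_univ, true_and, Equiv.Set.congr_apply]
    constructor
    · rintro h _ y ⟨x, hx, rfl⟩ hxy
      exact ⟨e.symm y, h x _ hx (by simpa [comap] using hxy), by simp⟩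
    · intro h x y hx hxy
      obtain ⟨z, hz, hzy⟩ := h (e x) (e y) ⟨x, hx, rfl⟩ hxy
      rwa [← e.injective hzy]
  · intro I _
    have h1 : ((H.comap e.toEmbedding).restrict Iᶜ).cls = (H.restrict (e '' I)ᶜ).cls :=
      cls_eq_cls_iff.2 (restrict_isom e H (by simp))
    have h2 : ((H.comap e.toEmbedding).restrict I).cls = (H.restrict (e '' I)).cls :=
      cls_eq_cls_iff.2 (restrict_isom e H (by simp))
    simp only [of, h1, h2]
    rfl

/-- The coproduct `Δ` of `F[G]`, the linear extension of `comulGraph`; the counit sends the empty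
mixed graph to `1` and all the other ones to `0`. -/
instance : CoalgebraStruct K (MixedGraphSpace K) where
  comul := (basis K).constr K
    (Quotient.lift (fun G : Σ n : ℕ, MixedGraph (Fin n) => comulGraph K G.2)
      (fun _ _ h => comulGraph_eq_of_isom K h))
  counit := (basis K).coord emptyClass

theorem comul_of {V : Type*} [Fintype V] (G : MixedGraph V) :
    CoalgebraStruct.comul (R := K) (of K G) = comulGraph K G := by
  refine ((basis K).constr_basis K _ _).trans ?_
  exact comulGraph_eq_of_isom K ⟨(Finite.equivFin V).symm, rfl⟩

/-- The product `↷` of `F[G]`, the bilinear extension of `G ↷ H`. -/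
def joinMul : MixedGraphSpace K →ₗ[K] MixedGraphSpace K →ₗ[K] MixedGraphSpace K :=
  (basis K).constr K fun c => (basis K).constr K fun d => basis K (c.join d)

theorem joinMul_of {V W : Type*} [Finite V] [Finite W] (G : MixedGraph V) (H : MixedGraph W) :
    joinMul K (of K G) (of K H) = of K (G.join H) := by
  have h : joinMul K (of K G) = (basis K).constr K fun d => basis K (G.cls.join d) :=
    (basis K).constr_basis K _ _
  rw [h]
  exact ((basis K).constr_basis K _ _).trans (congrArg (basis K) (cls_join G H))

end MixedGraphSpace

/-- `(A, mul, one, Δ, ε)` is a unital infinitesimal bialgebra: `mul` is associative with unit `one`,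
`Δ` is coassociative with counit `ε`, and
`Δ(x y) = (x ⊗ 1) Δ(y) + Δ(x) (1 ⊗ y) - x ⊗ y`, where `A ⊗ A` has the componentwise product. -/
structure IsUnitalInfinitesimalBialgebra (K A : Type*) [Field K] [AddCommGroup A] [Module K A]
    [CoalgebraStruct K A] (mul : A →ₗ[K] A →ₗ[K] A) (one : A) : Prop where
  mul_assoc : ∀ x y z, mul (mul x y) z = mul x (mul y z)
  one_mul : ∀ x, mul one x = x
  mul_one : ∀ x, mul x one = x
  coassoc : TensorProduct.assoc K A A A ∘ₗ
      (CoalgebraStruct.comul (R := K) (A := A)).rTensor A ∘ₗ CoalgebraStruct.comul =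
    (CoalgebraStruct.comul (R := K) (A := A)).lTensor A ∘ₗ CoalgebraStruct.comul
  counit_left : (CoalgebraStruct.counit (R := K) (A := A)).rTensor A ∘ₗ CoalgebraStruct.comul =
    TensorProduct.mk K K A 1
  counit_right : (CoalgebraStruct.counit (R := K) (A := A)).lTensor A ∘ₗ CoalgebraStruct.comul =
    (TensorProduct.mk K A K).flip 1
  comul_mul : ∀ x y, CoalgebraStruct.comul (R := K) (mul x y) =
    TensorProduct.map₂ mul mul (x ⊗ₜ[K] one) (CoalgebraStruct.comul (R := K) y) +
      TensorProduct.map₂ mul mul (CoalgebraStruct.comul (R := K) x) (one ⊗ₜ[K] y) - x ⊗ₜ[K] y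

/-- The space of primitive elements, `Δ(x) = x ⊗ 1 + 1 ⊗ x`. -/
def primitiveElements (K A : Type*) [Field K] [AddCommGroup A] [Module K A]
    [CoalgebraStruct K A] [One A] : Submodule K A where
  carrier := {x | CoalgebraStruct.comul (R := K) x = x ⊗ₜ[K] 1 + 1 ⊗ₜ[K] x}
  zero_mem' := by simp
  add_mem' {x y} hx hy := by
    simp only [Set.mem_ofPred_eq] at hx hy ⊢
    rw [map_add, hx, hy, TensorProduct.add_tmul, TensorProduct.tmul_add]
    abel
  smul_mem' c x hx := by
    simp only [Set.mem_ofPred_eq] at hx ⊢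
    rw [map_smul, hx, smul_add, TensorProduct.smul_tmul', TensorProduct.tmul_smul]

namespace TensorCoalgebra

variable (K V : Type*) [Field K] [AddCommGroup V] [Module K V]

/-- For `i ≤ n`, the identification of `{0, …, i - 1} ⊔ {0, …, n - i - 1}` with `{0, …, n - 1}`
(concatenation of intervals). -/
def splitEquiv {n : ℕ} (i : Fin (n + 1)) : Fin i ⊕ Fin (n - i) ≃ Fin n :=
  finSumFinEquiv.trans (finCongr (by omega))

/-- Deconcatenation on `V^{⊗ n}`:
`v₁ … vₙ ↦ ∑ v₁ … vᵢ ⊗ vᵢ₊₁ … vₙ`, the sum being over `0 ≤ i ≤ n`. -/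
def deconcatPower (n : ℕ) :
    (⨂[K]^n V) →ₗ[K] TensorAlgebra K V ⊗[K] TensorAlgebra K V :=
  ∑ i : Fin (n + 1), PiTensorProduct.lift
    (((TensorAlgebra.tprod K V i).domCoprod (TensorAlgebra.tprod K V (n - i))).domDomCongr
      (splitEquiv i))

/-- The deconcatenation coproduct of `T(V)`, with counit the projection onto `V^{⊗ 0} = K`. -/
instance deconcatenation : CoalgebraStruct K (TensorAlgebra K V) where
  comul := (DirectSum.toModule K ℕ _ (deconcatPower K V)) ∘ₗ
    (TensorAlgebra.equivDirectSum (R := K) (M := V)).toLinearMap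
  counit := (TensorAlgebra.algebraMapInv (R := K) (M := V)).toLinearMap

theorem comul_tprod {n : ℕ} (v : Fin n → V) :
    CoalgebraStruct.comul (R := K) (TensorAlgebra.tprod K V n v) =
      ∑ i : Fin (n + 1),
        TensorAlgebra.tprod K V i (fun j => v ⟨j, by omega⟩) ⊗ₜ[K]
          TensorAlgebra.tprod K V (n - i) (fun j => v ⟨i + j, by omega⟩) := by
  have h : CoalgebraStruct.comul (R := K) (TensorAlgebra.tprod K V n v) =
      DirectSum.toModule K ℕ _ (deconcatPower K V)
        (TensorAlgebra.equivDirectSum (TensorAlgebra.tprod K V n v)) := rfl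
  have h2 : TensorAlgebra.equivDirectSum (TensorAlgebra.tprod K V n v) =
      DirectSum.lof K ℕ (fun n => ⨂[K]^n V) n (PiTensorProduct.tprod K v) :=
    TensorAlgebra.toDirectSum_tensorPower_tprod v
  rw [h, h2, DirectSum.toModule_lof, deconcatPower, LinearMap.sum_apply]
  refine Finset.sum_congr rfl fun i _ => ?_
  rw [PiTensorProduct.lift.tprod]
  rfl

end TensorCoalgebra

end

/-! Part 1 is a count of ideals. An ideal of `G ↷ H` is an ideal of `H`, or an ideal of `G` together
with all of `H`; the only one of both kinds is the vertex set of `H`, and inclusion–exclusion turns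
this overlap into the term `- x ⊗ y`. Coassociativity holds because both iterated coproducts are
sums over chains `A ⊆ B` of ideals.

Part 2 is the Loday–Ronco theorem, proved with convolution. Filtering by the number of vertices
makes the coalgebra connected, so a linear map `f` killing `1` is locally nilpotent for convolution
and `1 - f` is invertible, `1` being unit ∘ counit. In particular the identity has a convolution
inverse `S`. The infinitesimal relation shows that `e = 1 - S` takes primitive values and that `e (v
a) = ε(a) v` for primitive `v`. Let `φ` be the algebra map from `T(Prim)` extending the inclusion,
and let `ψ` be the convolution inverse of `1 - ι ∘ e`, that is, `x ↦ ∑ e(x₁) ⋯ e(xₙ)` over iterated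
coproducts. Since `φ ∘ (1 - ι ∘ e) = S`, the composite `φ ∘ ψ` is the identity; since `ψ (v a) = v
ψ(a)`, so is `ψ ∘ φ`. Left multiplication by a primitive obeys the same coproduct rule on both
sides, so `φ` is a coalgebra map. -/

noncomputable section

/-! ### Geometric series in a convolution algebra -/

open Filter WithConv LinearMap in
/-- If `f` is locally nilpotent for the convolution product, then `1 - f` is invertible. -/
theorem LinearMap.isUnit_one_sub_of_locally_nilpotent {K C B : Type*} [CommRing K] [AddCommGroup C]
    [Module K C] [Coalgebra K C] [Ring B] [Algebra K B] (f : WithConv (C →ₗ[K] B))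
    (hf : ∀ x, ∀ᶠ n in atTop, (f ^ n) x = 0) : IsUnit (1 - f) := by
  have hfin : ∀ x, (Function.support fun n => (f ^ n) x).Finite := fun x => by
    obtain ⟨N, hN⟩ := eventually_atTop.1 (hf x)
    refine (Set.finite_lt_nat N).subset fun n hn => ?_
    by_contra h
    exact hn (hN n (not_lt.1 h))
  -- The inverse is the geometric series in `f`, a finite sum at each point.
  let g : C →ₗ[K] B :=
    { toFun x := ∑ᶠ n, (f ^ n) x
      map_add' x y := by
        rw [← finsum_add_distrib (hfin x) (hfin y)]
        exact finsum_congr fun n => map_add _ _ _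
      map_smul' c x := by
        rw [RingHom.id_apply, smul_finsum' c (hfin x)]
        exact finsum_congr fun n => map_smul _ _ _ }
  let s : ℕ → WithConv (C →ₗ[K] B) := fun n => ∑ i ∈ Finset.range n, f ^ i
  have hg : ∀ x, ∀ᶠ n in atTop, g x = (s n) x := fun x => by
    obtain ⟨N, hN⟩ := eventually_atTop.1 (hf x)
    refine eventually_atTop.2 ⟨N, fun n hn => ?_⟩
    have h1 : g x = ∑ i ∈ Finset.range n, (f ^ i) x :=
      finsum_eq_sum_of_support_subset _ fun i hi => by
        by_contra h
        exact hi (hN i (by simp at h; omega))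
    rw [h1]
    simp [s]
  -- A tensor involves finitely many elements of `C`, so one partial sum can replace `g` on all of
  -- `comul x`.
  have hgl : ∀ (k : C →ₗ[K] B) (t : C ⊗[K] C), ∀ᶠ n in atTop,
      TensorProduct.map g k t = TensorProduct.map (s n).ofConv k t := fun k t => by
    induction t with
    | zero => simp
    | tmul x y => filter_upwards [hg x] with n hn; simp [hn]
    | add x y hx hy => filter_upwards [hx, hy] with n h1 h2; simp [h1, h2]
  have hgr : ∀ (k : C →ₗ[K] B) (t : C ⊗[K] C), ∀ᶠ n in atTop,
      TensorProduct.map k g t = TensorProduct.map k (s n).ofConv t := fun k t => by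
    induction t with
    | zero => simp
    | tmul x y => filter_upwards [hg y] with n hn; simp [hn]
    | add x y hx hy => filter_upwards [hx, hy] with n h1 h2; simp [h1, h2]
  refine ⟨⟨1 - f, toConv g, ?_, ?_⟩, rfl⟩
  · ext x
    obtain ⟨n, h1, h2⟩ := ((hgr (1 - f).ofConv (Coalgebra.comul x)).and (hf x)).exists
    have h3 : (1 - f) * s n = 1 - f ^ n := mul_neg_geom_sum f n
    have h4 : ((1 - f) * toConv g) x = ((1 - f) * s n) x := by
      simp only [convMul_apply, h1]
    rw [h4, h3]
    simp [h2]
  · ext x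
    obtain ⟨n, h1, h2⟩ := ((hgl (1 - f).ofConv (Coalgebra.comul x)).and (hf x)).exists
    have h3 : s n * (1 - f) = 1 - f ^ n := geom_sum_mul_neg f n
    have h4 : (toConv g * (1 - f)) x = (s n * (1 - f)) x := by
      simp only [convMul_apply, h1]
    rw [h4, h3]
    simp [h2]

/-! ### Recursive description of the deconcatenation coproduct -/

namespace TensorCoalgebra

variable {K V : Type*} [Field K] [AddCommGroup V] [Module K V]

open TensorAlgebra

/-- A linear property which holds for `1` and is preserved by the left multiplications by the
generators holds on the tensor algebra. -/
theorem induction_ι_mul {C : TensorAlgebra K V → Prop} (one : C 1)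
    (smul : ∀ (c : K) a, C a → C (c • a)) (add : ∀ a b, C a → C b → C (a + b))
    (ι_mul : ∀ v a, C a → C (ι K v * a)) (a : TensorAlgebra K V) : C a := by
  -- In this stronger form the property of `a` is stable under products, so the usual induction
  -- applies.
  suffices h : ∀ b, C b → C (a * b) by simpa using h 1 one
  induction a using TensorAlgebra.induction with
  | algebraMap r => intro b hb; rw [← Algebra.smul_def]; exact smul r b hb
  | ι v => exact ι_mul v
  | mul x y hx hy => intro b hb; rw [mul_assoc]; exact hx _ (hy _ hb)
  | add x y hx hy => intro b hb; rw [add_mul]; exact add _ _ (hx _ hb) (hy _ hb)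

theorem ι_mul_tprod (v : V) {n : ℕ} (w : Fin n → V) :
    ι K v * tprod K V n w = tprod K V (n + 1) (Fin.cons v w) := by
  simp [tprod_apply, List.ofFn_succ]

theorem tprod_zero (w : Fin 0 → V) : tprod K V 0 w = 1 := by
  simp [tprod_apply]

theorem tprod_congr {m n : ℕ} (h : m = n) (v : Fin m → V) (w : Fin n → V)
    (hvw : ∀ j : Fin m, v j = w (Fin.cast h j)) : tprod K V m v = tprod K V n w := by
  subst h
  exact congrArg _ (funext hvw)

theorem mem_span_tprod (a : TensorAlgebra K V) :
    a ∈ Submodule.span K {a | ∃ n w, a = tprod K V n w} := by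
  induction a using induction_ι_mul with
  | one => exact Submodule.subset_span ⟨0, Fin.elim0, (tprod_zero _).symm⟩
  | smul c a ha => exact Submodule.smul_mem _ c ha
  | add a b ha hb => exact Submodule.add_mem _ ha hb
  | ι_mul v a ha =>
    induction ha using Submodule.span_induction with
    | mem a ha =>
      obtain ⟨n, w, rfl⟩ := ha
      exact Submodule.subset_span ⟨n + 1, _, ι_mul_tprod v w⟩
    | zero => simp
    | add a b _ _ ha hb => rw [mul_add]; exact Submodule.add_mem _ ha hb
    | smul c a _ ha => rw [mul_smul_comm]; exact Submodule.smul_mem _ c ha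

theorem comul_one :
    CoalgebraStruct.comul (R := K) (1 : TensorAlgebra K V) = 1 ⊗ₜ[K] 1 := by
  have h := comul_tprod K V (n := 0) Fin.elim0
  simpa [tprod_zero] using h

/-- A cut of the word `v a` either leaves `v` on the left and cuts `a`, or precedes `v`. With the
value at `1`, this determines the coproduct. -/
theorem comul_ι_mul (v : V) (a : TensorAlgebra K V) :
    CoalgebraStruct.comul (R := K) (ι K v * a) =
      (ι K v ⊗ₜ[K] 1) * CoalgebraStruct.comul (R := K) a + 1 ⊗ₜ[K] (ι K v * a) := by
  induction mem_span_tprod a using Submodule.span_induction with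
  | mem a ha =>
    obtain ⟨n, w, rfl⟩ := ha
    -- The term `i = 0` is the cut before `v`; the terms `i.succ` are the cuts of `w`.
    rw [ι_mul_tprod, comul_tprod, comul_tprod, Fin.sum_univ_succ, add_comm, Finset.mul_sum]
    congr 1
    · refine Finset.sum_congr rfl fun i _ => ?_
      rw [Algebra.TensorProduct.tmul_mul_tmul, one_mul]
      congr 1
      · rw [ι_mul_tprod]
        refine tprod_congr rfl _ _ fun j => ?_
        refine Fin.cases ?_ (fun j => ?_) j <;> rfl
      · refine tprod_congr (by simp) _ _ fun j => ?_
        have : (⟨(i.succ : ℕ) + j, by have := j.2; have := i.2; simp at *; omega⟩ : Fin (n + 1)) =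
            Fin.succ ⟨i + j, by have := j.2; have := i.2; simp at *; omega⟩ := by
          ext; simp; omega
        rw [this, Fin.cons_succ]
        rfl
    · congr 1
      refine tprod_congr rfl _ _ fun j => ?_
      congr 1
      exact Fin.ext (Nat.zero_add _)
  | zero => simp
  | add a b _ _ ha hb => simp only [mul_add, map_add, ha, hb, TensorProduct.tmul_add]; abel
  | smul c a _ ha =>
    simp only [mul_smul_comm, map_smul, ha, TensorProduct.tmul_smul, smul_add]

theorem counit_one : CoalgebraStruct.counit (R := K) (1 : TensorAlgebra K V) = 1 :=
  map_one (algebraMapInv (R := K) (M := V))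

theorem counit_ι_mul (v : V) (a : TensorAlgebra K V) :
    CoalgebraStruct.counit (R := K) (ι K v * a) = 0 := by
  refine (map_mul (algebraMapInv (R := K) (M := V)) _ _).trans ?_
  simp [algebraMapInv]

end TensorCoalgebra

/-! ### The Loday–Ronco theorem -/

namespace InfinitesimalBialgebra

open WithConv LinearMap Coalgebra

variable {K A : Type*} [Field K] [Ring A] [Algebra K A] [Coalgebra K A]

theorem comul_one (hc : ∀ x y : A, comul (R := K) (x * y) = (x ⊗ₜ[K] 1) * comul y +
      comul x * (1 ⊗ₜ[K] y) - x ⊗ₜ[K] y) : comul (R := K) (1 : A) = 1 ⊗ₜ[K] 1 := by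
  have h := hc 1 1
  rw [← Algebra.TensorProduct.one_def, one_mul, mul_one, one_mul] at h
  rw [← Algebra.TensorProduct.one_def]
  linear_combination (norm := abel) -h

/-- The term `v ⊗ a` of `Δ(v) (1 ⊗ a)` cancels `- v ⊗ a`. What remains is the rule
`TensorCoalgebra.comul_ι_mul` for generators of the tensor algebra. -/
theorem comul_mul_of_mem (hc : ∀ x y : A, comul (R := K) (x * y) = (x ⊗ₜ[K] 1) * comul y +
      comul x * (1 ⊗ₜ[K] y) - x ⊗ₜ[K] y) {v : A} (hv : v ∈ primitiveElements K A) (a : A) :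
    comul (R := K) (v * a) = (v ⊗ₜ[K] 1) * comul a + 1 ⊗ₜ[K] (v * a) := by
  have hv' : comul (R := K) v = v ⊗ₜ[K] 1 + 1 ⊗ₜ[K] v := hv
  rw [hc, hv', add_mul]
  simp only [Algebra.TensorProduct.tmul_mul_tmul, one_mul, mul_one]
  abel

theorem convMul_mul_of_mem (hc : ∀ x y : A, comul (R := K) (x * y) = (x ⊗ₜ[K] 1) * comul y +
      comul x * (1 ⊗ₜ[K] y) - x ⊗ₜ[K] y) {B : Type*} [Ring B] [Algebra K B]
    (f g : WithConv (A →ₗ[K] B)) {v : A} (hv : v ∈ primitiveElements K A) (a : A) :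
    (f * g) (v * a) = (toConv (f.ofConv ∘ₗ mulLeft K v) * g) a + f 1 * g (v * a) := by
  simp only [convMul_apply, comul_mul_of_mem hc hv, map_add]
  congr 1
  · induction comul (R := K) a with
    | zero => simp
    | tmul x y => simp
    | add x y hx hy => simp only [mul_add, map_add, hx, hy]

/-- The convolution unit is idempotent; evaluated at `v a`, this reads `ε(va) = ε(va) + ε(1) ε(va)`.
-/
theorem counit_mul_of_mem (hc : ∀ x y : A, comul (R := K) (x * y) = (x ⊗ₜ[K] 1) * comul y +
      comul x * (1 ⊗ₜ[K] y) - x ⊗ₜ[K] y) (h1 : counit (R := K) (1 : A) = 1)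
    {v : A} (hv : v ∈ primitiveElements K A) (a : A) :
    counit (R := K) (v * a) = 0 := by
  have h := convMul_mul_of_mem hc (1 : WithConv (A →ₗ[K] K)) 1 hv a
  rw [mul_one, mul_one] at h
  simpa [h1] using h

/-- In the convolution algebra of a connected coalgebra, the linear maps that vanish on `1` are
locally nilpotent. -/
theorem pow_apply_eq_zero (F : ℕ → Submodule K A)
    (hF0 : ∀ x ∈ F 0, x ∈ Submodule.span K {(1 : A)})
    (hF : ∀ n, ∀ x ∈ F (n + 1), comul (R := K) x - 1 ⊗ₜ[K] x ∈
      LinearMap.range ((F n).subtype.lTensor A))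
    {B : Type*} [Ring B] [Algebra K B] (f : WithConv (A →ₗ[K] B)) (hf : f 1 = 0)
    (n : ℕ) (x : A) (hx : x ∈ F n) : (f ^ (n + 1)) x = 0 := by
  induction n generalizing x with
  | zero =>
    obtain ⟨c, rfl⟩ := Submodule.mem_span_singleton.1 (hF0 x hx)
    simp [hf]
  | succ n ih =>
    obtain ⟨t, ht⟩ := hF n x hx
    have h2 : (f ^ (n + 1)).ofConv ∘ₗ (F n).subtype = 0 := by
      ext y
      exact ih y y.2
    -- Of `Δ(x)`, the part `1 ⊗ x` dies because `f 1 = 0`, and the rest has right factors in `F n`,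
    -- which `f ^ (n + 1)` kills.
    rw [pow_succ', convMul_apply, ← sub_add_cancel (comul x) (1 ⊗ₜ[K] x), ← ht, map_add, map_add,
      ← LinearMap.comp_apply (TensorProduct.map _ _), LinearMap.map_comp_lTensor, h2]
    simp [hf]

theorem isUnit_one_sub (F : ℕ → Submodule K A) (hmono : Monotone F) (hexh : ∀ x, ∃ n, x ∈ F n)
    (hF0 : ∀ x ∈ F 0, x ∈ Submodule.span K {(1 : A)})
    (hF : ∀ n, ∀ x ∈ F (n + 1), comul (R := K) x - 1 ⊗ₜ[K] x ∈
      LinearMap.range ((F n).subtype.lTensor A))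
    {B : Type*} [Ring B] [Algebra K B] (f : WithConv (A →ₗ[K] B)) (hf : f 1 = 0) :
    IsUnit (1 - f) := by
  refine isUnit_one_sub_of_locally_nilpotent f fun x => ?_
  obtain ⟨n, hn⟩ := hexh x
  refine Filter.eventually_atTop.2 ⟨n + 1, fun m hm => ?_⟩
  obtain ⟨m, rfl⟩ : ∃ k, m = k + 1 := ⟨m - 1, by omega⟩
  exact pow_apply_eq_zero F hF0 hF f hf m x (hmono (by omega) hn)

/-- **Loday–Ronco**: a connected unital infinitesimal bialgebra is isomorphic, as a coalgebra, to
the tensor coalgebra on the space of its primitive elements. -/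
theorem nonempty_coalgEquiv_tensorAlgebra
    (hc : ∀ x y : A, comul (R := K) (x * y) = (x ⊗ₜ[K] 1) * comul y +
      comul x * (1 ⊗ₜ[K] y) - x ⊗ₜ[K] y)
    (h1 : counit (R := K) (1 : A) = 1)
    (F : ℕ → Submodule K A) (hmono : Monotone F) (hexh : ∀ x, ∃ n, x ∈ F n)
    (hF0 : ∀ x ∈ F 0, x ∈ Submodule.span K {(1 : A)})
    (hF : ∀ n, ∀ x ∈ F (n + 1), comul (R := K) x - 1 ⊗ₜ[K] x ∈
      LinearMap.range ((F n).subtype.lTensor A)) :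
    Nonempty (A ≃ₗc[K] TensorAlgebra K (primitiveElements K A)) := by
  have hΔ1 := comul_one hc
  let I : WithConv (A →ₗ[K] A) := toConv LinearMap.id
  -- Here `I = 1 - (1 - I)`, and `1 - I` vanishes at `1` because `ε(1) = 1`.
  obtain ⟨u, hu⟩ : IsUnit I := by
    have := isUnit_one_sub F hmono hexh hF0 hF (1 - I) (by simp [I, h1, LinearMap.convOne_def])
    rwa [sub_sub_cancel] at this
  let S : WithConv (A →ₗ[K] A) := ↑u⁻¹
  have hSI : S * I = 1 := by rw [← hu]; exact u.inv_mul
  have hIS : I * S = 1 := by rw [← hu]; exact u.mul_inv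
  have hS1 : S 1 = 1 := by
    have := congrArg (fun f : WithConv (A →ₗ[K] A) => f 1) hSI
    simpa [hΔ1, I, h1] using this
  -- the coproduct of `S`
  let i₁ : A →ₐ[K] A ⊗[K] A := Algebra.TensorProduct.includeLeft
  let i₂ : A →ₐ[K] A ⊗[K] A := Algebra.TensorProduct.includeRight
  let D : WithConv (A →ₗ[K] A ⊗[K] A) := toConv comul
  let DS : WithConv (A →ₗ[K] A ⊗[K] A) := toConv (comul ∘ₗ S.ofConv)
  let I₁ : WithConv (A →ₗ[K] A ⊗[K] A) := toConv i₁.toLinearMap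
  let I₂ : WithConv (A →ₗ[K] A ⊗[K] A) := toConv i₂.toLinearMap
  let S₁ : WithConv (A →ₗ[K] A ⊗[K] A) := toConv (i₁.toLinearMap ∘ₗ S.ofConv)
  let S₂ : WithConv (A →ₗ[K] A ⊗[K] A) := toConv (i₂.toLinearMap ∘ₗ S.ofConv)
  have hSI₁ : S₁ * I₁ = 1 := by
    have h := algHom_comp_convMul_distrib i₁ S I
    rw [hSI] at h
    refine WithConv.ext (h.symm.trans ?_)
    ext x
    simp [LinearMap.convOne_def]
  have hIS₂ : I₂ * S₂ = 1 := by
    have h := algHom_comp_convMul_distrib i₂ I S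
    rw [hIS] at h
    refine WithConv.ext (h.symm.trans ?_)
    ext x
    simp [LinearMap.convOne_def]
  have hD : D = I₁ * I₂ := by
    ext x
    rw [convMul_apply]
    change comul x = _
    induction comul (R := K) x with
    | zero => simp
    | tmul x y => simp [I₁, I₂, i₁, i₂]
    | add x y hx hy => rw [map_add, map_add, ← hx, ← hy]
  -- This is `Δ` applied to `S * I = 1`, with `Δ(S(x₁) x₂)` expanded by the infinitesimal relation.
  have hDS : (1 : WithConv (A →ₗ[K] A ⊗[K] A)) = S₁ * D + DS * I₂ - S₁ * I₂ := by
    ext x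
    have h : (1 : WithConv (A →ₗ[K] A ⊗[K] A)) x = comul (R := K) ((S * I) x) := by
      rw [hSI]
      simp [Algebra.algebraMap_eq_smul_one, hΔ1, Algebra.TensorProduct.one_def]
    change (1 : WithConv (A →ₗ[K] A ⊗[K] A)) x = (S₁ * D) x + (DS * I₂) x - (S₁ * I₂) x
    rw [h]
    simp only [convMul_apply]
    induction comul (R := K) x with
    | zero => simp
    | tmul x y => simp [S₁, D, DS, I₂, I, i₁, i₂, hc]
    | add x y hx hy => simp only [map_add, hx, hy]; abel
  -- Substituting `D = I₁ * I₂` and `S₁ * I₁ = 1` makes `I₂` a right factor of every term but the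
  -- unit; convolving with `S₂` removes it.
  have hDS' : DS = S₁ + S₂ - 1 := by
    rw [hD, ← mul_assoc, hSI₁, one_mul] at hDS
    have h := congrArg (· * S₂) hDS
    simp only [sub_mul, add_mul, mul_assoc, hIS₂, mul_one, one_mul] at h
    linear_combination (norm := abel) -h
  have hprim : ∀ x, (1 - S) x ∈ primitiveElements K A := fun x => by
    have h : comul (R := K) (S x) = S x ⊗ₜ[K] 1 + 1 ⊗ₜ[K] S x -
        counit (R := K) x • (1 ⊗ₜ[K] 1) := by
      have := congrArg (fun f : WithConv (A →ₗ[K] A ⊗[K] A) => f x) hDS'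
      simpa [DS, S₁, S₂, i₁, i₂, LinearMap.convOne_def, Algebra.algebraMap_eq_smul_one,
        Algebra.TensorProduct.one_def] using this
    change comul (R := K) ((1 - S) x) = (1 - S) x ⊗ₜ[K] 1 + 1 ⊗ₜ[K] (1 - S) x
    have h2 : (1 - S) x = counit (R := K) x • (1 : A) - S x := by
      simp [LinearMap.convOne_def, Algebra.algebraMap_eq_smul_one]
    rw [h2, map_sub, h, map_smul, hΔ1, TensorProduct.sub_tmul, TensorProduct.tmul_sub,
      TensorProduct.tmul_smul, ← TensorProduct.smul_tmul']
    abel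
  let e : A →ₗ[K] primitiveElements K A := (1 - S).ofConv.codRestrict _ hprim
  let p : WithConv (A →ₗ[K] TensorAlgebra K (primitiveElements K A)) :=
    toConv (TensorAlgebra.ι K ∘ₗ e)
  have he1 : e 1 = 0 := Subtype.ext (by simp [e, hS1, h1, LinearMap.convOne_def])
  -- Evaluating `S * I = 1` at `v b` gives `(S ∘ L_v) * I = - L_v`, where `L_v` is left
  -- multiplication by `v`. Convolving with `S` on the right gives `S (v a) = - ε(a) v`.
  have hev : ∀ (v : primitiveElements K A) (a : A), e (v * a) = counit (R := K) a • v := by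
    intro v a
    have hfv : toConv (S.ofConv ∘ₗ mulLeft K (v : A)) =
        toConv (-(mulLeft K (v : A) ∘ₗ (1 : WithConv (A →ₗ[K] A)).ofConv)) := by
      have h : toConv (S.ofConv ∘ₗ mulLeft K (v : A)) * I = toConv (-(mulLeft K (v : A))) := by
        ext b
        have h := convMul_mul_of_mem hc S I v.2 b
        rw [hSI, convOne_apply, counit_mul_of_mem hc h1 v.2, map_zero, hS1, one_mul] at h
        exact (neg_eq_of_add_eq_zero_left h.symm).symm
      have h' : toConv (-(mulLeft K (v : A) ∘ₗ (1 : WithConv (A →ₗ[K] A)).ofConv)) =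
          toConv (-(mulLeft K (v : A))) * S := by
        rw [← hIS]
        ext b
        simp only [convMul_apply, LinearMap.neg_apply, LinearMap.comp_apply, mulLeft_apply]
        induction comul (R := K) b with
        | zero => simp
        | tmul x y => simp [I, mul_assoc]
        | add x y hx hy => simp only [map_add, mul_add, neg_add, hx, hy]
      rw [h', ← h, mul_assoc, hIS, mul_one]
    have h2 := congrArg (fun f : WithConv (A →ₗ[K] A) => f a) hfv
    apply Subtype.ext
    simp only [LinearMap.comp_apply, mulLeft_apply, LinearMap.neg_apply, convOne_apply,
      Algebra.algebraMap_eq_smul_one, mul_smul_comm, mul_one] at h2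
    change (1 - S) (v * a) = counit (R := K) a • (v : A)
    have h3 : (1 - S) (v * a) = counit (R := K) ((v : A) * a) • (1 : A) - S (v * a) := by
      simp [LinearMap.convOne_def, Algebra.algebraMap_eq_smul_one]
    rw [h3, h2, counit_mul_of_mem hc h1 v.2, zero_smul, zero_sub, neg_neg]
  obtain ⟨w, hw⟩ := isUnit_one_sub F hmono hexh hF0 hF p (by simp [p, he1])
  let ψ : WithConv (A →ₗ[K] TensorAlgebra K (primitiveElements K A)) := ↑w⁻¹
  let φ : TensorAlgebra K (primitiveElements K A) →ₐ[K] A :=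
    TensorAlgebra.lift K (primitiveElements K A).subtype
  have hψ : ψ = 1 + p * ψ := by
    have h : (1 - p) * ψ = 1 := by rw [← hw]; exact w.mul_inv
    rw [sub_mul, one_mul] at h
    exact sub_eq_iff_eq_add.1 h
  have hφι : ∀ v, φ (TensorAlgebra.ι K v) = v := fun v => TensorAlgebra.lift_ι_apply _ _
  have hφψ : ∀ a, φ (ψ a) = a := by
    have h : (1 - p) * ψ = 1 := by rw [← hw]; exact w.mul_inv
    have h2 := algHom_comp_convMul_distrib φ (1 - p) ψ
    have h3 : toConv (φ.toLinearMap ∘ₗ (1 - p).ofConv) = S := by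
      ext x
      simp [p, hφι, e, LinearMap.convOne_def]
    have h4 : φ.toLinearMap ∘ₗ (1 : WithConv (A →ₗ[K] _)).ofConv =
        (1 : WithConv (A →ₗ[K] A)).ofConv := by
      ext x
      simp [LinearMap.convOne_def]
    rw [h, h3, h4] at h2
    -- Both `I` and `φ ∘ ψ` are convolution inverses of `S`, on the left and on the right.
    have h5 : I = toConv (φ.toLinearMap ∘ₗ ψ.ofConv) :=
      left_inv_eq_right_inv hIS (WithConv.ext h2.symm)
    intro a
    exact (congrArg (fun f : WithConv (A →ₗ[K] A) => f a) h5).symm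
  have hψ1 : ψ 1 = 1 := by
    have h := congrArg (fun f : WithConv (A →ₗ[K] _) => f 1) hψ
    simpa [hΔ1, h1, p, he1] using h
  -- Evaluate `ψ = 1 + p * ψ` at `v a`: the counit vanishes there, `p 1 = 0`, and `p (v x) = ε(x) v`
  -- by `hev`.
  have hψv : ∀ (v : primitiveElements K A) (a : A), ψ (v * a) = TensorAlgebra.ι K v * ψ a := by
    intro v a
    have h := congrArg (fun f : WithConv (A →ₗ[K] _) => f (v * a)) hψ
    have h2 := convMul_mul_of_mem hc p ψ v.2 a
    have h3 : (1 + p * ψ) ((v : A) * a) = (p * ψ) (v * a) := by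
      simp [counit_mul_of_mem hc h1 v.2]
    have h4 : p 1 = 0 := by simp [p, he1]
    have h5 : (toConv (p.ofConv ∘ₗ mulLeft K (v : A)) * ψ) a =
        TensorAlgebra.ι K v * (1 * ψ) a := by
      simp only [convMul_apply]
      induction comul (R := K) a with
      | zero => simp
      | tmul x y => simp [p, hev, LinearMap.convOne_def, Algebra.algebraMap_eq_smul_one]
      | add x y hx hy => simp only [map_add, mul_add, hx, hy]
    rw [h4, zero_mul, add_zero, h5, one_mul] at h2
    exact h.trans (h3.trans h2)
  have hψφ : ∀ t, ψ (φ t) = t := fun t => by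
    induction t using TensorCoalgebra.induction_ι_mul with
    | one => rw [map_one, hψ1]
    | smul c a ha => rw [map_smul, map_smul, ha]
    | add a b ha hb => rw [map_add, map_add, ha, hb]
    | ι_mul v a ha => rw [map_mul, hφι, hψv, ha]
  refine ⟨CoalgEquiv.symm
    { φ.toLinearMap with
      counit_comp := ?_
      map_comp_comul := ?_
      invFun := ψ.ofConv
      left_inv := hψφ
      right_inv := hφψ }⟩
  · ext t
    change counit (R := K) (φ t) = CoalgebraStruct.counit (R := K) t
    induction t using TensorCoalgebra.induction_ι_mul with
    | one => rw [map_one, h1, TensorCoalgebra.counit_one]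
    | smul c a ha => rw [map_smul, map_smul, map_smul, ha]
    | add a b ha hb => rw [map_add, map_add, map_add, ha, hb]
    | ι_mul v a ha =>
      rw [map_mul, hφι, counit_mul_of_mem hc h1 v.2, TensorCoalgebra.counit_ι_mul]
  · ext t
    change TensorProduct.map φ.toLinearMap φ.toLinearMap (CoalgebraStruct.comul (R := K) t) =
      comul (R := K) (φ t)
    induction t using TensorCoalgebra.induction_ι_mul with
    | one => simp [TensorCoalgebra.comul_one, hΔ1]
    | smul c a ha => rw [map_smul, map_smul, map_smul, map_smul, ha]
    | add a b ha hb => rw [map_add, map_add, map_add, map_add, ha, hb]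
    | ι_mul v a ha =>
      rw [map_mul φ, hφι, comul_mul_of_mem hc v.2, TensorCoalgebra.comul_ι_mul, map_add, ← ha]
      congr 1
      · change Algebra.TensorProduct.map φ φ _ = _ * Algebra.TensorProduct.map φ φ _
        rw [map_mul]
        simp [hφι]
      · simp [hφι]

end InfinitesimalBialgebra

/-! ### Isomorphisms of restrictions and joins; ideals of a join -/

open MixedGraph

namespace MixedGraph

/-- Presenting an induced subgraph by any injection with the right image spares explicit bijections
between subtypes below. -/
theorem isom_restrict {U V : Type*} (f : U ↪ V) {S : Set V} (hS : Set.range f = S)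
    {G : MixedGraph U} {H : MixedGraph V} (h : G = H.comap f) : G.Isom (H.restrict S) := by
  subst h hS
  exact ⟨Equiv.ofInjective f f.injective, rfl⟩

theorem isom_restrict_univ {V : Type*} (G : MixedGraph V) : G.Isom (G.restrict Set.univ) :=
  isom_restrict (Function.Embedding.refl V) (by ext; simp) rfl

theorem restrict_restrict_isom {V : Type*} (G : MixedGraph V) {S T : Set V} {J : Set S}
    (h : Subtype.val '' J = T) : ((G.restrict S).restrict J).Isom (G.restrict T) :=
  isom_restrict
    ((Function.Embedding.subtype (· ∈ J)).trans (Function.Embedding.subtype (· ∈ S)))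
    (by rw [← h]; ext; simp) rfl

theorem restrict_join_isom {V W : Type*} (G : MixedGraph V) (H : MixedGraph W) {I : Set V}
    {J : Set W} {S : Set (V ⊕ W)} (hI : Sum.inl ⁻¹' S = I) (hJ : Sum.inr ⁻¹' S = J) :
    ((G.restrict I).join (H.restrict J)).Isom ((G.join H).restrict S) := by
  refine isom_restrict
    ((Function.Embedding.subtype (· ∈ I)).sumMap (Function.Embedding.subtype (· ∈ J))) ?_ ?_
  · subst hI hJ
    ext (x | x) <;> simp
  · ext x y <;> rcases x with x | x <;> rcases y with y | y <;>
      simp [join, comap, restrict]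

theorem join_assoc_isom {U V W : Type*} (G : MixedGraph U) (H : MixedGraph V) (L : MixedGraph W) :
    ((G.join H).join L).Isom (G.join (H.join L)) := by
  refine ⟨Equiv.sumAssoc U V W, ?_⟩
  ext x y <;> rcases x with (x | x) | x <;> rcases y with (y | y) | y <;> simp [join, comap]

theorem empty_join_isom {U V : Type*} [IsEmpty U] (G : MixedGraph U) (H : MixedGraph V) :
    (G.join H).Isom H := by
  refine ⟨Equiv.emptySum U V, ?_⟩
  ext x y <;> rcases x with x | x <;> rcases y with y | y <;>
    first | exact isEmptyElim x | exact isEmptyElim y | simp [join, comap]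

theorem join_empty_isom {U V : Type*} [IsEmpty V] (G : MixedGraph U) (H : MixedGraph V) :
    (G.join H).Isom G := by
  refine ⟨Equiv.sumEmpty U V, ?_⟩
  ext x y <;> rcases x with x | x <;> rcases y with y | y <;>
    first | exact isEmptyElim x | exact isEmptyElim y | simp [join, comap]

theorem isom_of_isEmpty {U V : Type*} [IsEmpty U] [IsEmpty V] (G : MixedGraph U)
    (H : MixedGraph V) : G.Isom H := by
  refine ⟨Equiv.equivOfIsEmpty U V, ?_⟩
  ext x <;> exact isEmptyElim x

theorem isIdeal_univ {V : Type*} (G : MixedGraph V) : G.IsIdeal Set.univ :=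
  fun _ _ _ _ => trivial

theorem isIdeal_empty {V : Type*} (G : MixedGraph V) : G.IsIdeal ∅ :=
  fun _ _ h _ => h

/-- Once an ideal contains a vertex of `G`, the added arcs force all of `H` into it. -/
theorem isIdeal_join_iff {V W : Type*} (G : MixedGraph V) (H : MixedGraph W) (S : Set (V ⊕ W)) :
    (G.join H).IsIdeal S ↔ (Sum.inl ⁻¹' S = ∅ ∧ H.IsIdeal (Sum.inr ⁻¹' S)) ∨
      (G.IsIdeal (Sum.inl ⁻¹' S) ∧ Sum.inr ⁻¹' S = Set.univ) := by
  constructor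
  · intro h
    by_cases hS : Sum.inl ⁻¹' S = ∅
    · exact .inl ⟨hS, fun x y hx hxy => h (.inr x) (.inr y) hx hxy⟩
    · obtain ⟨x, hx⟩ := Set.nonempty_iff_ne_empty.2 hS
      exact .inr ⟨fun x y hx hxy => h (.inl x) (.inl y) hx hxy,
        Set.eq_univ_of_forall fun y => h (.inl x) (.inr y) hx trivial⟩
  · rintro (⟨h1, h2⟩ | ⟨h1, h2⟩) (x | x) (y | y) hx hxy
    · exact absurd hx (Set.eq_empty_iff_forall_notMem.1 h1 x)
    · exact absurd hx (Set.eq_empty_iff_forall_notMem.1 h1 x)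
    · exact hxy.elim
    · exact h2 x y hx hxy
    · exact h1 x y hx hxy
    · exact Set.eq_univ_iff_forall.1 h2 y
    · exact hxy.elim
    · exact Set.eq_univ_iff_forall.1 h2 y

end MixedGraph

/-! ### Associativity, unit and the infinitesimal relation -/

namespace MixedGraphSpace

variable (K : Type*) [Field K]

variable {K} in
theorem of_eq_of_isom {V W : Type*} [Finite V] [Finite W] {G : MixedGraph V} {H : MixedGraph W}
    (h : G.Isom H) : of K G = of K H :=
  congrArg (basis K) (cls_eq_cls_iff.2 h)

theorem of_of_isEmpty {V : Type*} [Finite V] [IsEmpty V] (G : MixedGraph V) : of K G = 1 :=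
  of_eq_of_isom (isom_of_isEmpty G (edgeless (Fin 0)))

theorem of_restrict_of_eq_univ {V : Type*} [Finite V] (G : MixedGraph V) {I : Set V}
    (h : I = Set.univ) : of K (G.restrict I) = of K G := by
  subst h
  exact of_eq_of_isom (isom_restrict_univ G).symm

theorem of_restrict_of_eq_empty {V : Type*} [Finite V] (G : MixedGraph V) {I : Set V}
    (h : I = ∅) : of K (G.restrict I) = 1 := by
  subst h
  exact of_of_isEmpty K _

theorem basis_mk {n : ℕ} (G : MixedGraph (Fin n)) :
    basis K (Quotient.mk isoSetoid ⟨n, G⟩) = of K G :=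
  congrArg (basis K) (Quotient.sound (s := isoSetoid)
    (show G.Isom _ from Isom.symm ⟨(Finite.equivFin (Fin n)).symm, rfl⟩))

variable {K} in
@[elab_as_elim]
theorem induction_of {C : MixedGraphSpace K → Prop} (zero : C 0)
    (of : ∀ (n : ℕ) (G : MixedGraph (Fin n)), C (of K G))
    (smul : ∀ (c : K) x, C x → C (c • x)) (add : ∀ x y, C x → C y → C (x + y))
    (x : MixedGraphSpace K) : C x := by
  induction (basis K).mem_span x using Submodule.span_induction with
  | mem x hx =>
    obtain ⟨c, rfl⟩ := hx
    induction c using Quotient.inductionOn with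
    | h G => rw [basis_mk]; exact of _ _
  | zero => exact zero
  | add x y _ _ hx hy => exact add x y hx hy
  | smul c x _ hx => exact smul c x hx

variable {K} in
theorem linearMap_ext {M : Type*} [AddCommMonoid M] [Module K M] {f g : MixedGraphSpace K →ₗ[K] M}
    (h : ∀ (n : ℕ) (G : MixedGraph (Fin n)), f (of K G) = g (of K G)) : f = g := by
  ext x
  induction x using induction_of with
  | zero => simp
  | of n G => exact h n G
  | smul c x hx => simp [hx]
  | add x y hx hy => simp [hx, hy]

theorem counit_one : CoalgebraStruct.counit (R := K) (1 : MixedGraphSpace K) = 1 := by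
  change (basis K).coord emptyClass (basis K emptyClass) = 1
  simp

theorem counit_of_nonempty {V : Type*} [Finite V] [Nonempty V] (G : MixedGraph V) :
    CoalgebraStruct.counit (R := K) (of K G) = 0 := by
  change (basis K).coord emptyClass (basis K G.cls) = 0
  have h : G.cls ≠ emptyClass := fun h => by
    obtain ⟨e, -⟩ := cls_eq_cls_iff.1 h
    exact (e (Classical.arbitrary V)).elim0
  simp [h]

theorem joinMul_assoc (x y z : MixedGraphSpace K) :
    joinMul K (joinMul K x y) z = joinMul K x (joinMul K y z) := by
  induction x using induction_of with
  | zero => simp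
  | smul c x hx => simp [hx]
  | add x x' hx hx' => simp [hx, hx']
  | of l G =>
  induction y using induction_of with
  | zero => simp
  | smul c x hx => simp [hx]
  | add x x' hx hx' => simp [hx, hx']
  | of m H =>
  induction z using induction_of with
  | zero => simp
  | smul c x hx => simp [hx]
  | add x x' hx hx' => simp [hx, hx']
  | of n L =>
  simp only [joinMul_of]
  exact of_eq_of_isom (join_assoc_isom G H L)

theorem one_eq_of : (1 : MixedGraphSpace K) = of K (edgeless (Fin 0)) := rfl

theorem one_joinMul (x : MixedGraphSpace K) : joinMul K 1 x = x := by
  induction x using induction_of with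
  | zero => simp
  | smul c x hx => simp [hx]
  | add x x' hx hx' => simp [hx, hx']
  | of n G => rw [one_eq_of, joinMul_of]; exact of_eq_of_isom (empty_join_isom _ _)

theorem joinMul_one (x : MixedGraphSpace K) : joinMul K x 1 = x := by
  induction x using induction_of with
  | zero => simp
  | smul c x hx => simp [hx]
  | add x x' hx hx' => simp [hx, hx']
  | of n G => rw [one_eq_of, joinMul_of]; exact of_eq_of_isom (join_empty_isom _ _)

-- Inclusion–exclusion over the two kinds of ideals: `P` collects those missing `G`, `Q` those
-- containing `H`, and `P ∩ Q` is the single pair `(∅, univ)`, which contributes `G ⊗ H`.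
open Classical in
theorem comul_of_join {V W : Type*} [Fintype V] [Fintype W] (G : MixedGraph V)
    (H : MixedGraph W) :
    CoalgebraStruct.comul (R := K) (of K (G.join H)) =
      TensorProduct.map₂ (joinMul K) (joinMul K) (of K G ⊗ₜ[K] 1) (comulGraph K H) +
      TensorProduct.map₂ (joinMul K) (joinMul K) (comulGraph K G) (1 ⊗ₜ[K] of K H) -
      of K G ⊗ₜ[K] of K H := by
  let t : Set V × Set W → MixedGraphSpace K ⊗[K] MixedGraphSpace K := fun p =>
    of K ((G.restrict p.1ᶜ).join (H.restrict p.2ᶜ)) ⊗ₜ[K]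
      of K ((G.restrict p.1).join (H.restrict p.2))
  let P : Finset (Set V × Set W) := {∅} ×ˢ Finset.univ.filter fun J => H.IsIdeal J
  let Q : Finset (Set V × Set W) := (Finset.univ.filter fun I => G.IsIdeal I) ×ˢ {Set.univ}
  have h1 : CoalgebraStruct.comul (R := K) (of K (G.join H)) = ∑ p ∈ P ∪ Q, t p := by
    rw [comul_of, comulGraph]
    refine Finset.sum_bij' (fun S _ => (Sum.inl ⁻¹' S, Sum.inr ⁻¹' S))
      (fun p _ => Sum.inl '' p.1 ∪ Sum.inr '' p.2) ?_ ?_ ?_ ?_ ?_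
    · intro S hS
      simpa only [P, Q, Finset.mem_union, Finset.mem_product, Finset.mem_singleton,
        Finset.mem_filter, Finset.mem_univ, true_and, isIdeal_join_iff] using hS
    · rintro ⟨I, J⟩ h
      have e1 : (Sum.inl ⁻¹' (Sum.inl '' I ∪ Sum.inr '' J : Set (V ⊕ W))) = I := by ext; simp
      have e2 : (Sum.inr ⁻¹' (Sum.inl '' I ∪ Sum.inr '' J : Set (V ⊕ W))) = J := by ext; simp
      simp only [Finset.mem_filter, Finset.mem_univ, true_and, isIdeal_join_iff, e1, e2]
      simpa only [P, Q, Finset.mem_union, Finset.mem_product, Finset.mem_singleton,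
        Finset.mem_filter, Finset.mem_univ, true_and] using h
    · intro S _
      ext (x | x) <;> simp
    · rintro ⟨I, J⟩ _
      ext <;> simp
    · intro S _
      exact congrArg₂ (TensorProduct.tmul K)
        (of_eq_of_isom (restrict_join_isom G H rfl rfl).symm)
        (of_eq_of_isom (restrict_join_isom G H rfl rfl).symm)
  have h2 : ∑ p ∈ P, t p =
      TensorProduct.map₂ (joinMul K) (joinMul K) (of K G ⊗ₜ[K] 1) (comulGraph K H) := by
    simp only [P, Finset.sum_product, Finset.sum_singleton, comulGraph, map_sum, t]
    refine Finset.sum_congr rfl fun J _ => ?_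
    simp only [TensorProduct.map₂_apply_tmul, TensorProduct.map_tmul, ← joinMul_of,
      of_restrict_of_eq_univ K G Set.compl_empty, of_restrict_of_eq_empty K G rfl]
  have h3 : ∑ p ∈ Q, t p =
      TensorProduct.map₂ (joinMul K) (joinMul K) (comulGraph K G) (1 ⊗ₜ[K] of K H) := by
    simp only [Q, Finset.sum_product, Finset.sum_singleton, comulGraph, map_sum,
      LinearMap.sum_apply, t]
    refine Finset.sum_congr rfl fun I _ => ?_
    simp only [TensorProduct.map₂_apply_tmul, TensorProduct.map_tmul, ← joinMul_of,
      of_restrict_of_eq_univ K H rfl, of_restrict_of_eq_empty K H Set.compl_univ]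
  have h4 : ∑ p ∈ P ∩ Q, t p = of K G ⊗ₜ[K] of K H := by
    have : P ∩ Q = {(∅, Set.univ)} := by
      ext ⟨I, J⟩
      simp only [P, Q, Finset.mem_inter, Finset.mem_product, Finset.mem_singleton,
        Finset.mem_filter, Finset.mem_univ, true_and, Prod.mk.injEq]
      constructor
      · rintro ⟨⟨h, -⟩, -, h'⟩
        exact ⟨h, h'⟩
      · rintro ⟨rfl, rfl⟩
        exact ⟨⟨rfl, isIdeal_univ H⟩, isIdeal_empty G, rfl⟩
    rw [this, Finset.sum_singleton]
    simp only [t, ← joinMul_of, of_restrict_of_eq_univ K G Set.compl_empty,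
      of_restrict_of_eq_empty K G rfl, of_restrict_of_eq_univ K H rfl,
      of_restrict_of_eq_empty K H Set.compl_univ, one_joinMul, joinMul_one]
  rw [h1, ← h2, ← h3, ← h4, ← Finset.sum_union_inter, add_sub_cancel_right]

theorem comul_joinMul (x y : MixedGraphSpace K) :
    CoalgebraStruct.comul (R := K) (joinMul K x y) =
      TensorProduct.map₂ (joinMul K) (joinMul K) (x ⊗ₜ[K] 1) (CoalgebraStruct.comul (R := K) y) +
      TensorProduct.map₂ (joinMul K) (joinMul K) (CoalgebraStruct.comul (R := K) x) (1 ⊗ₜ[K] y) -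
      x ⊗ₜ[K] y := by
  induction x using induction_of with
  | zero => simp
  | smul c x hx =>
    simp only [map_smul, LinearMap.smul_apply, hx, ← TensorProduct.smul_tmul', smul_add, smul_sub]
  | add x x' hx hx' =>
    simp only [map_add, LinearMap.add_apply, hx, hx', TensorProduct.add_tmul]
    abel
  | of l G =>
  induction y using induction_of with
  | zero => simp
  | smul c x hx =>
    simp only [map_smul, hx, TensorProduct.tmul_smul, smul_add, smul_sub]
  | add x x' hx hx' =>
    simp only [map_add, hx, hx', TensorProduct.tmul_add]
    abel
  | of m H =>
  rw [joinMul_of, comul_of_join, comul_of, comul_of]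

end MixedGraphSpace

/-! ### Ideals of restrictions, coassociativity and counit -/

namespace MixedGraph

theorem IsIdeal.restrict_iff {V : Type*} {G : MixedGraph V} {I : Set V} (hI : G.IsIdeal I)
    (J : Set I) : (G.restrict I).IsIdeal J ↔ G.IsIdeal (Subtype.val '' J) := by
  constructor
  · rintro h _ y ⟨x, hx, rfl⟩ hxy
    exact ⟨⟨y, hI x y x.2 hxy⟩, h x _ hx hxy, rfl⟩
  · intro h x y hx hxy
    obtain ⟨z, hz, hzy⟩ := h x y ⟨x, hx, rfl⟩ hxy
    rwa [← Subtype.ext hzy]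

theorem IsIdeal.restrict_compl_iff {V : Type*} {G : MixedGraph V} {I : Set V} (hI : G.IsIdeal I)
    (J : Set ↥Iᶜ) : (G.restrict Iᶜ).IsIdeal J ↔ G.IsIdeal (I ∪ Subtype.val '' J) := by
  constructor
  · rintro h x y (hx | ⟨x, hx, rfl⟩) hxy
    · exact .inl (hI x y hx hxy)
    · by_cases hy : y ∈ I
      · exact .inl hy
      · exact .inr ⟨⟨y, hy⟩, h x ⟨y, hy⟩ hx hxy, rfl⟩
  · intro h x y hx hxy
    obtain hy | ⟨z, hz, hzy⟩ := h x y (.inr ⟨x, hx, rfl⟩) hxy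
    · exact absurd hy y.2
    · rwa [← Subtype.ext hzy]

end MixedGraph

namespace MixedGraphSpace

variable (K : Type*) [Field K]

open Classical in
theorem comulGraph_restrict {V : Type*} [Fintype V] (G : MixedGraph V) {I : Set V}
    (hI : G.IsIdeal I) :
    comulGraph K (G.restrict I) = ∑ A : Set V with G.IsIdeal A ∧ A ⊆ I,
      of K (G.restrict (I \ A)) ⊗ₜ[K] of K (G.restrict A) := by
  refine Finset.sum_bij' (fun J _ => Subtype.val '' J) (fun A _ => Subtype.val ⁻¹' A) ?_ ?_ ?_ ?_ ?_
  · intro J hJ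
    simp only [Finset.mem_filter, Finset.mem_univ, true_and] at hJ ⊢
    exact ⟨(hI.restrict_iff J).1 hJ, Subtype.coe_image_subset I J⟩
  · intro A hA
    simp only [Finset.mem_filter, Finset.mem_univ, true_and] at hA ⊢
    rw [hI.restrict_iff, Subtype.image_preimage_coe, Set.inter_eq_right.2 hA.2]
    exact hA.1
  · intro J _
    exact Set.preimage_image_eq J Subtype.val_injective
  · intro A hA
    simp only [Finset.mem_filter, Finset.mem_univ, true_and] at hA
    rw [Subtype.image_preimage_coe, Set.inter_eq_right.2 hA.2]
  · intro J _
    refine congrArg₂ (TensorProduct.tmul K) (of_eq_of_isom (restrict_restrict_isom G ?_))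
      (of_eq_of_isom (restrict_restrict_isom G rfl))
    ext x; simp

open Classical in
theorem comulGraph_restrict_compl {V : Type*} [Fintype V] (G : MixedGraph V) {I : Set V}
    (hI : G.IsIdeal I) :
    comulGraph K (G.restrict Iᶜ) = ∑ B : Set V with G.IsIdeal B ∧ I ⊆ B,
      of K (G.restrict Bᶜ) ⊗ₜ[K] of K (G.restrict (B \ I)) := by
  have key : ∀ B : Set V, I ⊆ B → I ∪ (Subtype.val '' (Subtype.val ⁻¹' B : Set ↥Iᶜ)) = B := by
    intro B hB
    rw [Subtype.image_preimage_coe, Set.inter_comm, ← Set.sdiff_eq, Set.union_sdiff_cancel hB]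
  refine Finset.sum_bij' (fun J _ => I ∪ Subtype.val '' J) (fun B _ => Subtype.val ⁻¹' B)
    ?_ ?_ ?_ ?_ ?_
  · intro J hJ
    simp only [Finset.mem_filter, Finset.mem_univ, true_and] at hJ ⊢
    exact ⟨(hI.restrict_compl_iff J).1 hJ, Set.subset_union_left⟩
  · intro B hB
    simp only [Finset.mem_filter, Finset.mem_univ, true_and] at hB ⊢
    rw [hI.restrict_compl_iff, key B hB.2]
    exact hB.1
  · intro J _
    ext ⟨x, hx⟩
    simp
  · intro B hB
    simp only [Finset.mem_filter, Finset.mem_univ, true_and] at hB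
    exact key B hB.2
  · intro J _
    refine congrArg₂ (TensorProduct.tmul K) (of_eq_of_isom (restrict_restrict_isom G ?_))
      (of_eq_of_isom (restrict_restrict_isom G ?_))
    · ext x
      simp
    · ext x
      simp only [Set.mem_image, Subtype.exists, Set.mem_sdiff, Set.mem_union]
      grind

-- Both sides are the sum of `G_{|Bᶜ} ⊗ G_{|B ∖ A} ⊗ G_{|A}` over chains of ideals `A ⊆ B`; they
-- differ only in which ideal is chosen first.
open CoalgebraStruct in
theorem coassoc : TensorProduct.assoc K (MixedGraphSpace K) (MixedGraphSpace K)
      (MixedGraphSpace K) ∘ₗ (comul (R := K) (A := MixedGraphSpace K)).rTensor _ ∘ₗ comul =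
    (comul (R := K) (A := MixedGraphSpace K)).lTensor _ ∘ₗ comul := by
  classical
  refine linearMap_ext fun n G => ?_
  simp only [LinearMap.comp_apply, comul_of, comulGraph, map_sum, LinearMap.rTensor_tmul,
    LinearMap.lTensor_tmul, LinearEquiv.coe_coe]
  have h1 : ∀ I ∈ Finset.univ.filter fun I : Set (Fin n) => G.IsIdeal I,
      TensorProduct.assoc K (MixedGraphSpace K) (MixedGraphSpace K) (MixedGraphSpace K)
        (comulGraph K (G.restrict Iᶜ) ⊗ₜ[K] of K (G.restrict I)) =
      ∑ B : Set (Fin n) with G.IsIdeal B ∧ I ⊆ B,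
        of K (G.restrict Bᶜ) ⊗ₜ[K] (of K (G.restrict (B \ I)) ⊗ₜ[K] of K (G.restrict I)) := by
    intro I hI
    simp only [Finset.mem_filter, Finset.mem_univ, true_and] at hI
    rw [comulGraph_restrict_compl K G hI, TensorProduct.sum_tmul, map_sum]
    simp only [TensorProduct.assoc_tmul]
  have h2 : ∀ I ∈ Finset.univ.filter fun I : Set (Fin n) => G.IsIdeal I,
      of K (G.restrict Iᶜ) ⊗ₜ[K] comulGraph K (G.restrict I) =
      ∑ A : Set (Fin n) with G.IsIdeal A ∧ A ⊆ I,
        of K (G.restrict Iᶜ) ⊗ₜ[K] (of K (G.restrict (I \ A)) ⊗ₜ[K] of K (G.restrict A)) := by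
    intro I hI
    simp only [Finset.mem_filter, Finset.mem_univ, true_and] at hI
    rw [comulGraph_restrict K G hI, TensorProduct.tmul_sum]
  refine (Finset.sum_congr rfl h1).trans (Eq.trans ?_ (Finset.sum_congr rfl h2).symm)
  refine Finset.sum_comm' fun A B => ?_
  simp only [Finset.mem_filter, Finset.mem_univ, true_and]
  tauto

open CoalgebraStruct in
theorem rTensor_counit_comp_comul :
    (counit (R := K) (A := MixedGraphSpace K)).rTensor _ ∘ₗ comul = TensorProduct.mk K K _ 1 := by
  classical
  refine linearMap_ext fun n G => ?_
  simp only [LinearMap.comp_apply, comul_of, comulGraph, map_sum, LinearMap.rTensor_tmul,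
    TensorProduct.mk_apply]
  -- The counit retains only the ideal with empty complement.
  rw [Finset.sum_eq_single Set.univ]
  · rw [of_restrict_of_eq_empty K G Set.compl_univ, counit_one, of_restrict_of_eq_univ K G rfl]
  · intro I _ hI
    have : Nonempty ↥Iᶜ := (Set.nonempty_compl.2 hI).to_subtype
    rw [counit_of_nonempty, TensorProduct.zero_tmul]
  · intro h
    simp [isIdeal_univ] at h

open CoalgebraStruct in
theorem lTensor_counit_comp_comul :
    (counit (R := K) (A := MixedGraphSpace K)).lTensor _ ∘ₗ comul =
      (TensorProduct.mk K _ K).flip 1 := by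
  classical
  refine linearMap_ext fun n G => ?_
  simp only [LinearMap.comp_apply, comul_of, comulGraph, map_sum, LinearMap.lTensor_tmul,
    LinearMap.flip_apply, TensorProduct.mk_apply]
  rw [Finset.sum_eq_single ∅]
  · rw [of_restrict_of_eq_empty K G rfl, counit_one, of_restrict_of_eq_univ K G Set.compl_empty]
  · intro I _ hI
    have : Nonempty ↥I := (Set.nonempty_iff_ne_empty.2 hI).to_subtype
    rw [counit_of_nonempty, TensorProduct.tmul_zero]
  · intro h
    simp [isIdeal_empty] at h

/-! ### Connectedness: the filtration by number of vertices -/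

/-- The subspace of `F[G]` spanned by the graphs with at most `n` vertices. -/
def filtration (n : ℕ) : Submodule K (MixedGraphSpace K) :=
  Submodule.span K {x | ∃ m ≤ n, ∃ G : MixedGraph (Fin m), x = of K G}

theorem filtration_mono : Monotone (filtration K) := fun _ _ h =>
  Submodule.span_mono fun _ ⟨m, hm, G, hG⟩ => ⟨m, hm.trans h, G, hG⟩

theorem of_mem_filtration {V : Type*} [Finite V] (G : MixedGraph V) {n : ℕ}
    (h : Nat.card V ≤ n) : of K G ∈ filtration K n :=
  Submodule.subset_span ⟨Nat.card V, h, G.comap (Finite.equivFin V).symm.toEmbedding,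
    of_eq_of_isom (Isom.symm ⟨_, rfl⟩)⟩

theorem exists_mem_filtration (x : MixedGraphSpace K) : ∃ n, x ∈ filtration K n := by
  induction x using induction_of with
  | zero => exact ⟨0, zero_mem _⟩
  | of n G => exact ⟨n, of_mem_filtration K G (by simp)⟩
  | smul c x hx => exact hx.imp fun n hn => Submodule.smul_mem _ c hn
  | add x y hx hy =>
    obtain ⟨m, hm⟩ := hx
    obtain ⟨n, hn⟩ := hy
    exact ⟨max m n, add_mem (filtration_mono K (le_max_left m n) hm)
      (filtration_mono K (le_max_right m n) hn)⟩

theorem filtration_zero_le : filtration K 0 ≤ Submodule.span K {1} := by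
  refine Submodule.span_le.2 ?_
  rintro _ ⟨m, hm, G, rfl⟩
  obtain rfl := Nat.le_zero.1 hm
  rw [of_of_isEmpty]
  exact Submodule.mem_span_singleton_self 1

/-- The subtracted term is the summand of the full ideal; every other ideal is a proper subset and
so has fewer vertices. -/
theorem comul_sub_mem_range {n : ℕ} {x : MixedGraphSpace K} (hx : x ∈ filtration K (n + 1)) :
    CoalgebraStruct.comul (R := K) x - 1 ⊗ₜ[K] x ∈
      LinearMap.range ((filtration K n).subtype.lTensor (MixedGraphSpace K)) := by
  classical
  induction hx using Submodule.span_induction with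
  | zero => simp
  | add x y _ _ hx hy =>
    rw [map_add, TensorProduct.tmul_add, add_sub_add_comm]
    exact add_mem hx hy
  | smul c x _ hx =>
    rw [map_smul, TensorProduct.tmul_smul, ← smul_sub]
    exact Submodule.smul_mem _ c hx
  | mem x hx =>
    obtain ⟨m, hm, G, rfl⟩ := hx
    have h : (1 : MixedGraphSpace K) ⊗ₜ[K] of K G =
        of K (G.restrict (Set.univ)ᶜ) ⊗ₜ[K] of K (G.restrict Set.univ) := by
      rw [of_restrict_of_eq_empty K G Set.compl_univ, of_restrict_of_eq_univ K G rfl]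
    rw [comul_of, comulGraph, h, ← Finset.add_sum_erase _ _ (a := Set.univ)
      (by simp [isIdeal_univ]), add_sub_cancel_left]
    refine Submodule.sum_mem _ fun I hI => ?_
    have hI' : I ≠ Set.univ := (Finset.mem_erase.1 hI).1
    refine ⟨of K (G.restrict Iᶜ) ⊗ₜ[K] ⟨of K (G.restrict I), of_mem_filtration K _ ?_⟩, rfl⟩
    have h1 : I.ncard < (Set.univ : Set (Fin m)).ncard :=
      Set.ncard_lt_ncard (Set.ssubset_univ_iff.2 hI')
    rw [Set.ncard_univ, Nat.card_fin] at h1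
    rw [Nat.card_coe_set_eq]
    omega

theorem isUnitalInfinitesimalBialgebra :
    IsUnitalInfinitesimalBialgebra K (MixedGraphSpace K) (joinMul K) 1 where
  mul_assoc := joinMul_assoc K
  one_mul := one_joinMul K
  mul_one := joinMul_one K
  coassoc := coassoc K
  counit_left := rTensor_counit_comp_comul K
  counit_right := lTensor_counit_comp_comul K
  comul_mul := comul_joinMul K

/-! ### Application of the Loday–Ronco theorem -/

section

/-- `F[G]` as a ring, for the product `↷`. -/
@[reducible]
def joinRing : Ring (MixedGraphSpace K) where
  __ := instAddCommGroup K
  __ := instOne K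
  mul x y := joinMul K x y
  left_distrib x y z := map_add (joinMul K x) y z
  right_distrib x y z := LinearMap.map_add₂ (joinMul K) x y z
  zero_mul x := LinearMap.map_zero₂ (joinMul K) x
  mul_zero x := map_zero (joinMul K x)
  mul_assoc := joinMul_assoc K
  one_mul := one_joinMul K
  mul_one := joinMul_one K

attribute [local instance] joinRing

/-- `F[G]` as an algebra, for the product `↷`. -/
@[reducible]
def joinAlgebra : Algebra K (MixedGraphSpace K) :=
  Algebra.ofModule (fun c x y => LinearMap.map_smul₂ (joinMul K) c x y)
    (fun c x y => map_smul (joinMul K x) c y)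

attribute [local instance] joinAlgebra

/-- `F[G]` as a coalgebra. -/
@[reducible]
def coalgebra : Coalgebra K (MixedGraphSpace K) where
  coassoc := coassoc K
  rTensor_counit_comp_comul := rTensor_counit_comp_comul K
  lTensor_counit_comp_comul := lTensor_counit_comp_comul K

attribute [local instance] coalgebra

/-- Translates the infinitesimal relation from bilinear maps into the ring structure of the tensor
square, the form that the general theorem takes as hypothesis. -/
theorem map₂_joinMul (s t : MixedGraphSpace K ⊗[K] MixedGraphSpace K) :
    TensorProduct.map₂ (joinMul K) (joinMul K) s t = s * t := by
  induction s with
  | zero => simp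
  | add s s' hs hs' => rw [map_add, LinearMap.add_apply, hs, hs', add_mul]
  | tmul a b =>
  induction t with
  | zero => simp
  | add t t' ht ht' => rw [map_add, ht, ht', mul_add]
  | tmul c d =>
    rw [TensorProduct.map₂_apply_tmul, TensorProduct.map_tmul,
      Algebra.TensorProduct.tmul_mul_tmul]
    rfl

theorem nonempty_coalgEquiv_tensorAlgebra :
    Nonempty (MixedGraphSpace K ≃ₗc[K]
      TensorAlgebra K (primitiveElements K (MixedGraphSpace K))) := by
  refine InfinitesimalBialgebra.nonempty_coalgEquiv_tensorAlgebra (fun x y => ?_) (counit_one K)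
    (filtration K) (filtration_mono K) (exists_mem_filtration K) (filtration_zero_le K)
    fun n x hx => comul_sub_mem_range K hx
  have h := comul_joinMul K x y
  rwa [map₂_joinMul, map₂_joinMul] at h

end

end MixedGraphSpace

end

theorem corollary1p9 (K : Type*) [Field K] [CharZero K] :
    IsUnitalInfinitesimalBialgebra K (MixedGraphSpace K) (MixedGraphSpace.joinMul K) 1 ∧
    Nonempty (MixedGraphSpace K ≃ₗc[K]
      TensorAlgebra K (primitiveElements K (MixedGraphSpace K))) :=
  ⟨MixedGraphSpace.isUnitalInfinitesimalBialgebra K,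
    MixedGraphSpace.nonempty_coalgEquiv_tensorAlgebra K⟩
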